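/- Let $G$ be a finite undirected graph with vertex set $V$ and edge set $E$, possibly with loops and multiple edges, and let $b\in\mathbb{R}^V$ have nonnegative entries. For $v\in V$ let $\delta_G(v)$ be the set of edges incident with $v$ (a loop attached to $v$ appears once in it), and let $$\mathcal{P}(G,b)=\Bigl\{x\in\mathbb{R}^E\Bigm| x_e\ge 0\text{ for each }e\in E,\ \sum_{e\in\delta_G(v)}x_e=b_v\text{ for each }v\in V\Bigr\}$$ be the fractional perfect $b$-matching polytope of $G$. The graph of $x\in\mathcal{P}(G,b)$ is the spanning subgraph of $G$ with edge set $\{e\in E\mid x_e>0\}$. A vertex with a loop attached to it counts as a cycle of length $1$, and two distinct vertices joined by two distinct edges count as a cycle of length $2$. Let $H$ be the graph of a vertex $u$ of $\mathcal{P}(G,b)$. Then $u$ is the only element of $\mathcal{P}(G,b)$ whose graph is $H$, and, for each $e\in E$, $$u_e=\begin{cases}\displaystyle k_e\sum_{v\in V_{H\setminus e}(t_e)}(-1)^{d_{H\setminus e}(v,t_e)}\,b_v,&e\text{ is an edge of }H,\\ 0,&\text{otherwise.}\end{cases}$$ Here $k_e=\frac12$ if $e$ is an edge of a nonloop cycle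 of $H$, and $k_e=1$ otherwise; if $e$ is an edge of a component of $H$ that contains a single cycle $L$, but $e$ is not in $L$, then $t_e$ is the endpoint of $e$ furthest from $L$ (there is exactly one such endpoint), and otherwise $t_e$ is an arbitrarily chosen endpoint of $e$ (the formula holds for every choice); $H\setminus e$ is the graph obtained by deleting the edge $e$ from $H$; $V_{H\setminus e}(t_e)$ is the vertex set of the component of $H\setminus e$ which contains $t_e$; and, for each $v\in V_{H\setminus e}(t_e)$, there is exactly one path between $v$ and $t_e$ in $H\setminus e$, and $d_{H\setminus e}(v,t_e)$ is its length. -/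

import Mathlib

open scoped Graph

namespace Graph

/-- Walks from `x` to `y` in a multigraph `G`, as alternating sequences of vertices and edges.
Parallel edges give different walks. -/
inductive Walk {α β : Type*} (G : Graph α β) : α → α → Type _
  | nil {x : α} (hx : x ∈ V(G)) : Walk G x x
  | cons {x y z : α} (e : β) (he : G.IsLink e x y) (p : Walk G y z) : Walk G x z

namespace Walk

variable {α β : Type*} {G : Graph α β}

/-- The number of edges traversed by a walk. -/
def length : {x y : α} → G.Walk x y → ℕ
  | _, _, nil _ => 0
  | _, _, cons _ _ p => p.length + 1

/-- The list of the vertices visited by a walk, in order. -/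
def support : {x y : α} → G.Walk x y → List α
  | x, _, nil _ => [x]
  | x, _, cons _ _ p => x :: p.support

/-- The list of the edges traversed by a walk, in order. -/
def edges : {x y : α} → G.Walk x y → List β
  | _, _, nil _ => []
  | _, _, cons e _ p => e :: p.edges

/-- A path is a walk which visits no vertex twice. -/
def IsPath {x y : α} (p : G.Walk x y) : Prop := p.support.Nodup

end Walk

section

variable {α β : Type*}

/-- `G.Reachable x y` : the vertices `x` and `y` lie in the same component of `G`. -/
def Reachable (G : Graph α β) (x y : α) : Prop := Nonempty (G.Walk x y)

/-- `C` is a (connected) component of `G`. -/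
def IsComponent (C G : Graph α β) : Prop :=
  ∃ x ∈ V(G), C = G.induce {y | G.Reachable x y}

/-- `C` is a cycle of length `n`: it consists of a path together with one further edge which joins
the last vertex of the path to the first one. For `n = 1` this is a vertex with a loop attached to
it, and for `n = 2` it is two distinct vertices joined by two distinct edges. -/
def IsCycleOfLength (C : Graph α β) (n : ℕ) : Prop :=
  ∃ (x y : α) (p : C.Walk x y) (e : β), p.IsPath ∧ C.IsLink e y x ∧ e ∉ p.edges ∧
    V(C) = {v | v ∈ p.support} ∧ E(C) = insert e {f | f ∈ p.edges} ∧ n = p.length + 1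

/-- `L` is a cycle of `G`, i.e. a subgraph of `G` which is a cycle. -/
def IsCycleIn (L G : Graph α β) : Prop := L ≤ G ∧ ∃ n, L.IsCycleOfLength n

/-- `L` is the only cycle of `G`. -/
def IsOnlyCycleIn (L G : Graph α β) : Prop :=
  L.IsCycleIn G ∧ ∀ L' : Graph α β, L'.IsCycleIn G → L' = L

/-- The distance between `x` and `y`: the least length of a path between them. In particular it is
the length of the path between `x` and `y` whenever there is exactly one such path. -/
noncomputable def pathDist (G : Graph α β) (x y : α) : ℕ :=
  sInf {n | ∃ p : G.Walk x y, p.IsPath ∧ p.length = n}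

/-- The distance in `G` from the vertex `x` to the subgraph `L`: the least length of a path of `G`
from `x` to a vertex of `L`. -/
noncomputable def distTo (G : Graph α β) (x : α) (L : Graph α β) : ℕ :=
  sInf {n | ∃ w ∈ V(L), ∃ p : G.Walk x w, p.IsPath ∧ p.length = n}

/-- `t` is an allowed choice of an endpoint of the edge `e` of `H`: if `e` is an edge of a component
of `H` which contains a single cycle `L`, but `e` is not in `L`, then `t` has to be the endpoint of
`e` furthest from `L`; otherwise, `t` is an arbitrary endpoint of `e`. -/
def IsEndpointChoice (H : Graph α β) (e : β) (t : α) : Prop :=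
  H.Inc e t ∧ ∀ C L : Graph α β, C.IsComponent H → e ∈ E(C) → L.IsOnlyCycleIn C → e ∉ E(L) →
    ∀ s, H.Inc e s → s ≠ t → H.distTo s L < H.distTo t L

open Classical in
/-- The coefficient of the edge `e` of `H`: `1 / 2` if `e` is an edge of a nonloop cycle of `H`, and
`1` otherwise. -/
noncomputable def cycleCoeff (H : Graph α β) (e : β) : ℝ :=
  if ∃ L : Graph α β, L ≤ H ∧ (∃ n, n ≠ 1 ∧ L.IsCycleOfLength n) ∧ e ∈ E(L) then 1 / 2 else 1

open Classical in
/-- The fractional perfect `b`-matching polytope of `G`. A loop attached to `v` is counted once in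
the sum at `v`. -/
def fracPerfectMatchingPolytope (G : Graph α β) [Fintype E(G)] (b : V(G) → ℝ) : Set (E(G) → ℝ) :=
  {x | (∀ e, 0 ≤ x e) ∧ ∀ v : V(G), ∑ e : E(G), (if G.Inc e v then x e else 0) = b v}

/-- The graph of `x`: the spanning subgraph of `G` whose edge set is the support of `x`. -/
def supportGraph (G : Graph α β) (x : E(G) → ℝ) : Graph α β :=
  G.restrict (Subtype.val '' Function.support x)

end

end Graph

/-!
Let `u` be an extreme point with graph `H`. If a vector `y` supported on the edges of `H` has zero
sum at every vertex, then `u ± ε y` lies in the polytope for small `ε > 0`, so `y = 0`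
(`eq_zero_of_mem_extremePoints`). In particular `u` is the only point with graph `H`.

All the combinatorics comes from one consequence of this injectivity. Give loops weight `2` and
other edges weight `1`, and attach to a walk the alternating sum of its edges. The vertex sums of
this vector telescope to `1_x - (-1) ^ n 1_y` for a walk of length `n` from `x` to `y`
(`Walk.sum_inc_alternation`), so the vector depends only on `x`, `y` and the parity of `n`. This is
the property `IsRigid`. Thus an even closed walk of `H` has alternating vector zero; it cannot use
an edge exactly once, or exactly twice with the same sign. Suitable closed walks then show, for an
edge `e` of `H`, where "avoiding" means "in `H` without `e`":

* cycles are odd (`IsCycleOfLength.odd`), and every walk avoiding `e` that connects the ends of `e`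
  is even (`IsRigid.not_odd_of_isLink`);
* if the ends of `e` are connected by a walk avoiding `e`, no odd closed walk avoiding `e` starts at
  them (`IsRigid.not_odd_of_reachable`); hence a component has at most one cycle
  (`IsRigid.cycle_eq_of_reachable`);
* there are never odd closed walks avoiding `e` at both ends of `e` (`IsRigid.not_odd_both`).

An end `t` of `e` is an allowed choice if and only if no odd closed walk avoiding `e` starts at `t`
(`IsRigid.isEndpointChoice`, `IsEndpointChoice.not_odd`). So allowed choices exist, and for such `t`
the component of `t` without `e` is a tree: walks to `t` from the same vertex have the same parity,
and two paths with the same alternating vector are equal. Summing the vertex equations over this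
component with the signs `(-1) ^ d(v, t)`, the two ends of every edge other than `e` cancel, and
only a multiple of `u e` remains: `2 * u e` if `e` lies on a nonloop cycle and `u e` otherwise
(`IsEndpointChoice.eq_cycleCoeff_mul`).
-/

/-! ### Walks in multigraphs -/

namespace Graph

namespace Walk

variable {α β : Type*} {G : Graph α β} {x y z : α} {e f : β}

lemma left_mem : ∀ {x y : α}, G.Walk x y → x ∈ V(G)
  | _, _, nil hx => hx
  | _, _, cons _ he _ => he.left_mem

lemma right_mem : ∀ {x y : α}, G.Walk x y → y ∈ V(G)
  | _, _, nil hx => hx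
  | _, _, cons _ _ p => p.right_mem

lemma mem_edgeSet : ∀ {x y : α} (p : G.Walk x y), f ∈ p.edges → f ∈ E(G)
  | _, _, nil _, h => by simp [edges] at h
  | _, _, cons e he p, h => by
    rcases List.mem_cons.1 h with rfl | h
    · exact he.edge_mem
    · exact p.mem_edgeSet h

@[simp]
lemma length_edges : ∀ {x y : α} (p : G.Walk x y), p.edges.length = p.length
  | _, _, nil _ => rfl
  | _, _, cons _ _ p => by simp [edges, length, p.length_edges]

lemma start_mem_support : ∀ {x y : α} (p : G.Walk x y), x ∈ p.support
  | _, _, nil _ => by simp [support]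
  | _, _, cons _ _ _ => by simp [support]

lemma end_mem_support : ∀ {x y : α} (p : G.Walk x y), y ∈ p.support
  | _, _, nil _ => by simp [support]
  | _, _, cons _ _ p => by simp [support, p.end_mem_support]

lemma mem_support_of_inc : ∀ {x y : α} (p : G.Walk x y), f ∈ p.edges → G.Inc f z → z ∈ p.support
  | _, _, nil _, h, _ => by simp [edges] at h
  | _, _, cons e he p, h, hz => by
    rcases List.mem_cons.1 h with rfl | h
    · rcases hz.eq_or_eq_of_isLink he with rfl | rfl
      · exact List.mem_cons_self
      · exact List.mem_cons_of_mem _ p.start_mem_support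
    · exact List.mem_cons_of_mem _ (p.mem_support_of_inc h hz)

/-- Concatenation of walks. -/
def append : {x y z : α} → G.Walk x y → G.Walk y z → G.Walk x z
  | _, _, _, nil _, q => q
  | _, _, _, cons e he p, q => cons e he (p.append q)

@[simp]
lemma length_append : ∀ {x y z : α} (p : G.Walk x y) (q : G.Walk y z),
    (p.append q).length = p.length + q.length
  | _, _, _, nil _, q => by simp [append, length]
  | _, _, _, cons e he p, q => by simp [append, length, p.length_append q]; omega

@[simp]
lemma edges_append : ∀ {x y z : α} (p : G.Walk x y) (q : G.Walk y z),
    (p.append q).edges = p.edges ++ q.edges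
  | _, _, _, nil _, q => by simp [append, edges]
  | _, _, _, cons e he p, q => by simp [append, edges, p.edges_append q]

lemma mem_support_append_left : ∀ {x y z : α} (p : G.Walk x y) (q : G.Walk y z) {v : α},
    v ∈ p.support → v ∈ (p.append q).support
  | _, _, _, nil _, q, v, h => by
    simp only [support, List.mem_singleton] at h
    subst h
    exact q.start_mem_support
  | _, _, _, cons e he p, q, v, h => by
    rcases List.mem_cons.1 h with rfl | h
    · exact List.mem_cons_self
    · exact List.mem_cons_of_mem _ (p.mem_support_append_left q h)

/-- The walk traversed backwards. -/
def reverse : {x y : α} → G.Walk x y → G.Walk y x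
  | _, _, nil hx => nil hx
  | _, _, cons e he p => p.reverse.append (cons e he.symm (nil he.left_mem))

@[simp]
lemma length_reverse : ∀ {x y : α} (p : G.Walk x y), p.reverse.length = p.length
  | _, _, nil _ => rfl
  | _, _, cons e he p => by simp [reverse, length, p.length_reverse]

/-- A walk of `G` regarded as a walk of a graph `G'` in which the edges of the walk have the same
ends as in `G`. -/
def transfer (G' : Graph α β) : {x y : α} → (p : G.Walk x y) → x ∈ V(G') →
    (∀ f ∈ p.edges, ∀ a b, G.IsLink f a b → G'.IsLink f a b) → G'.Walk x y
  | _, _, nil _, hx, _ => nil hx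
  | _, _, cons e he p, _, h =>
    cons e (h e List.mem_cons_self _ _ he) (p.transfer G' (h e List.mem_cons_self _ _ he).right_mem
      fun f hf ↦ h f (List.mem_cons_of_mem _ hf))

@[simp]
lemma edges_transfer (G' : Graph α β) : ∀ {x y : α} (p : G.Walk x y) (hx : x ∈ V(G'))
    (h : ∀ f ∈ p.edges, ∀ a b, G.IsLink f a b → G'.IsLink f a b),
    (p.transfer G' hx h).edges = p.edges
  | _, _, nil _, _, _ => rfl
  | _, _, cons e he p, _, h => by simp [transfer, edges, edges_transfer G' p]

@[simp]
lemma support_transfer (G' : Graph α β) : ∀ {x y : α} (p : G.Walk x y) (hx : x ∈ V(G'))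
    (h : ∀ f ∈ p.edges, ∀ a b, G.IsLink f a b → G'.IsLink f a b),
    (p.transfer G' hx h).support = p.support
  | _, _, nil _, _, _ => rfl
  | _, _, cons e he p, _, h => by simp [transfer, support, support_transfer G' p]

@[simp]
lemma length_transfer (G' : Graph α β) (p : G.Walk x y) (hx : x ∈ V(G'))
    (h : ∀ f ∈ p.edges, ∀ a b, G.IsLink f a b → G'.IsLink f a b) :
    (p.transfer G' hx h).length = p.length := by
  rw [← length_edges, edges_transfer, length_edges]

/-- A walk of a subgraph regarded as a walk of the whole graph. -/
def mapLe {G' : Graph α β} (h : G ≤ G') (p : G.Walk x y) : G'.Walk x y :=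
  p.transfer G' (h.vertexSet_mono p.left_mem) fun _ _ _ _ hf ↦ h.isLink_mono hf

@[simp]
lemma edges_mapLe {G' : Graph α β} (h : G ≤ G') (p : G.Walk x y) :
    (p.mapLe h).edges = p.edges := edges_transfer ..

@[simp]
lemma support_mapLe {G' : Graph α β} (h : G ≤ G') (p : G.Walk x y) :
    (p.mapLe h).support = p.support := support_transfer ..

@[simp]
lemma length_mapLe {G' : Graph α β} (h : G ≤ G') (p : G.Walk x y) :
    (p.mapLe h).length = p.length := length_transfer ..

lemma notMem_edges_deleteEdges (p : (G.deleteEdges {e}).Walk x y) : e ∉ p.edges := fun h ↦ by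
  simpa using p.mem_edgeSet h

/-- A walk which does not use the edge `e`, regarded as a walk of the graph without `e`. -/
def toDeleteEdge (p : G.Walk x y) (e : β) (h : e ∉ p.edges) : (G.deleteEdges {e}).Walk x y :=
  p.transfer _ p.left_mem fun f hf a b hab ↦ by
    rw [deleteEdges_isLink]
    exact ⟨hab, fun hfe ↦ h (hfe ▸ hf)⟩

@[simp]
lemma length_toDeleteEdge (p : G.Walk x y) (e : β) (h : e ∉ p.edges) :
    (p.toDeleteEdge e h).length = p.length := length_transfer ..

lemma exists_append_of_mem_support : ∀ {x y : α} (p : G.Walk x y) {v : α}, v ∈ p.support →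
    ∃ (p₁ : G.Walk x v) (p₂ : G.Walk v y), p = p₁.append p₂
  | _, _, nil hx, v, h => by
    simp only [support, List.mem_singleton] at h
    subst h
    exact ⟨nil hx, nil hx, rfl⟩
  | x, _, cons e he p, v, h => by
    by_cases hv : v = x
    · subst hv
      exact ⟨nil he.left_mem, cons e he p, rfl⟩
    · obtain ⟨p₁, p₂, rfl⟩ := p.exists_append_of_mem_support
        ((List.mem_cons.1 h).resolve_left hv)
      exact ⟨cons e he p₁, p₂, rfl⟩

/-! ### Paths -/

lemma isPath_cons {he : G.IsLink e x y} {p : G.Walk y z} :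
    (cons e he p).IsPath ↔ x ∉ p.support ∧ p.IsPath := List.nodup_cons

lemma IsPath.of_append : ∀ {x y z : α} {p : G.Walk x y} {q : G.Walk y z},
    (p.append q).IsPath → p.IsPath ∧ q.IsPath
  | _, _, _, nil _, _, h => ⟨by simp [IsPath, support], h⟩
  | _, _, _, cons e he p, q, h => by
    have h' := isPath_cons.1 h
    have := IsPath.of_append h'.2
    exact ⟨isPath_cons.2 ⟨fun hx ↦ h'.1 (p.mem_support_append_left q hx), this.1⟩, this.2⟩

lemma IsPath.edges_eq_nil : ∀ {p : G.Walk x x}, p.IsPath → p.edges = []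
  | nil _, _ => rfl
  | cons _ _ p, h => ((isPath_cons.1 h).1 p.end_mem_support).elim

lemma IsPath.length_eq_zero {p : G.Walk x x} (h : p.IsPath) : p.length = 0 := by
  rw [← length_edges, h.edges_eq_nil, List.length_nil]

lemma isPath_mapLe {G' : Graph α β} (h : G ≤ G') {p : G.Walk x y} :
    (p.mapLe h).IsPath ↔ p.IsPath := by simp [IsPath]

lemma exists_isPath : ∀ {x y : α} (p : G.Walk x y),
    ∃ q : G.Walk x y, q.IsPath ∧ q.length ≤ p.length
  | _, _, nil hx => ⟨nil hx, by simp [IsPath, support], le_rfl⟩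
  | x, _, cons e he p => by
    obtain ⟨q, hq, hl⟩ := p.exists_isPath
    by_cases hx : x ∈ q.support
    · obtain ⟨q₁, q₂, rfl⟩ := q.exists_append_of_mem_support hx
      rw [length_append] at hl
      exact ⟨q₂, hq.of_append.2, by simp only [length]; omega⟩
    · exact ⟨cons e he q, isPath_cons.2 ⟨hx, hq⟩, by simp only [length]; omega⟩

/-- A path splits at each of its edges into two parts that avoid this edge. -/
lemma IsPath.exists_split : ∀ {x y : α} {p : G.Walk x y}, p.IsPath → e ∈ p.edges →
    ∃ (a b : α) (_ : (G.deleteEdges {e}).Walk x a) (_ : (G.deleteEdges {e}).Walk b y),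
      G.IsLink e a b ∧ a ≠ b
  | _, _, nil _, _, h => by simp [edges] at h
  | x, _, cons (y := z) f hf p, hp, h => by
    obtain ⟨hx, hp'⟩ := isPath_cons.1 hp
    by_cases hfe : f = e
    · subst hfe
      exact ⟨x, z, nil hf.left_mem,
        p.toDeleteEdge f fun h' ↦ hx (p.mem_support_of_inc h' hf.inc_left), hf,
        fun hxz ↦ hx (hxz ▸ p.start_mem_support)⟩
    · obtain ⟨a, b, q₁, q₂, hab, hne⟩ := IsPath.exists_split hp'
        ((List.mem_cons.1 h).resolve_left (Ne.symm hfe))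
      exact ⟨a, b, cons f (by rw [deleteEdges_isLink]; exact ⟨hf, hfe⟩) q₁, q₂, hab, hne⟩

/-- Cut a walk after its last use of the edge `e`: the remainder avoids `e`, and it starts at an
end of `e` unless the whole walk avoids `e`. -/
lemma exists_after_last {a b : α} (he : G.IsLink e a b) : ∀ {x y : α} (p : G.Walk x y),
    Nonempty ((G.deleteEdges {e}).Walk x y) ∨
      (∃ q : (G.deleteEdges {e}).Walk a y, q.length < p.length) ∨
      ∃ q : (G.deleteEdges {e}).Walk b y, q.length < p.length := by
  suffices H : ∀ {x y : α} (p : G.Walk x y),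
      (∃ q : (G.deleteEdges {e}).Walk x y, q.length ≤ p.length) ∨
      (∃ q : (G.deleteEdges {e}).Walk a y, q.length < p.length) ∨
      ∃ q : (G.deleteEdges {e}).Walk b y, q.length < p.length by
    intro x y p
    exact (H p).imp_left fun ⟨q, _⟩ ↦ ⟨q⟩
  intro x y p
  induction p with
  | nil hx => exact .inl ⟨nil hx, le_rfl⟩
  | cons f hf p ih =>
    rcases ih with ⟨q, hq⟩ | ⟨q, hq⟩ | ⟨q, hq⟩
    · by_cases hfe : f = e
      · subst hfe
        rcases hf.right_eq_or_eq he with rfl | rfl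
        · exact .inr (.inl ⟨q, by simp only [length]; omega⟩)
        · exact .inr (.inr ⟨q, by simp only [length]; omega⟩)
      · refine .inl ⟨cons f (by rw [deleteEdges_isLink]; exact ⟨hf, hfe⟩) q, ?_⟩
        simp only [length]; omega
    · exact .inr (.inl ⟨q, by simp only [length]; omega⟩)
    · exact .inr (.inr ⟨q, by simp only [length]; omega⟩)

end Walk

end Graph

namespace Graph

variable {α β : Type*} {G H K L L₁ L₂ : Graph α β} {x y z s t v : α} {e f : β} {w : β → ℝ} {n : ℕ}

/-! ### Alternating vectors of walks -/

open Classical in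
/-- The alternating vector `w e₁ • 1_{e₁} - w e₂ • 1_{e₂} + ⋯` of a list `e₁, e₂, …` of edges with
weights `w`. -/
noncomputable def alternation (w : β → ℝ) : List β → β → ℝ
  | [] => 0
  | e :: l => Pi.single e (w e) - alternation w l

open Classical in
lemma alternation_of_notMem : ∀ {l : List β}, f ∉ l → alternation w l f = 0
  | [], _ => rfl
  | e :: l, h => by
    rw [List.mem_cons, not_or] at h
    simp [alternation, alternation_of_notMem h.2, Pi.single_eq_of_ne h.1]

lemma alternation_cons_self (l : List β) :
    alternation w (e :: l) e = w e - alternation w l e := by simp [alternation]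

lemma alternation_append : ∀ l₁ l₂ : List β,
    alternation w (l₁ ++ l₂) = alternation w l₁ + (-1 : ℝ) ^ l₁.length • alternation w l₂
  | [], l₂ => by simp [alternation]
  | e :: l₁, l₂ => by
    simp only [List.cons_append, alternation, alternation_append l₁ l₂, List.length_cons, pow_succ]
    ext f
    simp only [Pi.sub_apply, Pi.add_apply, Pi.smul_apply, smul_eq_mul]
    ring

/-- The combinatorial trace of the injectivity of the vertex-edge incidence map on the edges of
`H`: for positive edge weights `w`, the alternating vector of a walk of `H` depends only on the two
ends of the walk and on the parity of its length. -/
structure IsRigid (H : Graph α β) (w : β → ℝ) : Prop where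
  weight_pos : ∀ e, 0 < w e
  alternation_eq : ∀ {x y : α} (p q : H.Walk x y), (Even p.length ↔ Even q.length) →
    alternation w p.edges = alternation w q.edges

namespace IsRigid

lemma alternation_eq_zero (hH : H.IsRigid w) (p : H.Walk x x) (hp : Even p.length) :
    alternation w p.edges = 0 :=
  hH.alternation_eq p (.nil p.left_mem) (by simp [hp, Walk.length])

/-- The alternating vector at `e` of an even closed walk that uses `e` only once is not zero. -/
lemma not_odd_of_isLink (hH : H.IsRigid w) (he : H.IsLink e x y)
    (q : (H.deleteEdges {e}).Walk y x) : ¬ Odd q.length := fun hq ↦ by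
  have h := congrFun (hH.alternation_eq_zero (.cons e he (q.mapLe deleteEdges_le))
    (by simpa [Walk.length] using hq.add_one)) e
  rw [Walk.edges, alternation_cons_self, Walk.edges_mapLe,
    alternation_of_notMem q.notMem_edges_deleteEdges] at h
  have := hH.weight_pos e
  simp at h
  linarith

/-- No odd closed walk avoids `e` and starts at an end of `e` if the ends of `e` are connected
without `e`. -/
lemma not_odd_of_reachable (hH : H.IsRigid w) (he : H.IsLink e x y)
    (q : (H.deleteEdges {e}).Walk y x) (o : (H.deleteEdges {e}).Walk x x) : ¬ Odd o.length := by
  intro ho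
  have hq := Nat.not_odd_iff_even.1 (hH.not_odd_of_isLink he q)
  exact hH.not_odd_of_isLink he (q.append o) (by simpa using hq.add_odd ho)

/-- Odd closed walks at both ends of `e` that avoid `e`, together with two traversals of `e` in
opposite directions, form an even closed walk in which both uses of `e` get the same sign. -/
lemma not_odd_both (hH : H.IsRigid w) (he : H.IsLink e x y)
    (o₁ : (H.deleteEdges {e}).Walk x x) (o₂ : (H.deleteEdges {e}).Walk y y)
    (h₁ : Odd o₁.length) : ¬ Odd o₂.length := fun h₂ ↦ by
  have h := congrFun (hH.alternation_eq_zero (.cons e he ((o₂.mapLe deleteEdges_le).append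
    (.cons e he.symm (o₁.mapLe deleteEdges_le))))
    (by simp only [Walk.length, Walk.length_append, Walk.length_mapLe]; grind)) e
  simp only [Walk.edges, Walk.edges_append, alternation_cons_self, alternation_append,
    Walk.edges_mapLe, Walk.length_edges, Pi.add_apply, Pi.smul_apply, h₂.neg_one_pow,
    alternation_of_notMem o₁.notMem_edges_deleteEdges,
    alternation_of_notMem o₂.notMem_edges_deleteEdges, Pi.zero_apply, smul_eq_mul] at h
  have := hH.weight_pos e
  linarith

/-- A path is determined by its ends and its alternating vector: its first edge is the only edge
in the support of this vector that is incident to its first vertex. -/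
lemma isPath_eq_of_alternation_eq (hw : ∀ e, 0 < w e) : ∀ {x y : α} {p q : K.Walk x y},
    p.IsPath → q.IsPath → alternation w p.edges = alternation w q.edges → p = q
  | _, _, .nil _, q, _, hq, _ => by
    cases q with
    | nil => rfl
    | cons f hf q => exact absurd q.end_mem_support (Walk.isPath_cons.1 hq).1
  | x, _, .cons e he p, q, hp, hq, h => by
    cases q with
    | nil hx => exact absurd p.end_mem_support (Walk.isPath_cons.1 hp).1
    | cons f hf q =>
      obtain ⟨hxp, hp'⟩ := Walk.isPath_cons.1 hp
      obtain ⟨hxq, hq'⟩ := Walk.isPath_cons.1 hq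
      have hef : e = f := by
        by_contra hef
        have hne : alternation w (f :: q.edges) e ≠ 0 := by
          simp only [Walk.edges] at h
          rw [← h, alternation_cons_self,
            alternation_of_notMem fun h' ↦ hxp (p.mem_support_of_inc h' he.inc_left), sub_zero]
          exact (hw e).ne'
        refine hne (alternation_of_notMem fun hmem ↦ ?_)
        rcases List.mem_cons.1 hmem with hmem | hmem
        · exact hef hmem
        · exact hxq (q.mem_support_of_inc hmem he.inc_left)
      subst hef
      obtain rfl := he.right_unique hf
      have h' : alternation w p.edges = alternation w q.edges := by
        simpa [Walk.edges, alternation] using h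
      rw [isPath_eq_of_alternation_eq hw hp' hq' h']

end IsRigid

/-! ### Cycles -/

namespace IsCycleOfLength

lemma ne_zero (hL : L.IsCycleOfLength n) : n ≠ 0 := by
  obtain ⟨x, y, p, e, -, -, -, -, -, rfl⟩ := hL
  omega

lemma exists_mem (hL : L.IsCycleOfLength n) : ∃ v, v ∈ V(L) := by
  obtain ⟨x, y, p, -⟩ := hL
  exact ⟨x, p.left_mem⟩

lemma reachable (hL : L.IsCycleOfLength n) (hx : x ∈ V(L)) (hy : y ∈ V(L)) : L.Reachable x y := by
  obtain ⟨a, b, p, e, -, -, -, hV, -⟩ := hL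
  rw [hV] at hx hy
  obtain ⟨p₁, -, -⟩ := p.exists_append_of_mem_support hx
  obtain ⟨p₂, -, -⟩ := p.exists_append_of_mem_support hy
  exact ⟨p₁.reverse.append p₂⟩

lemma exists_closed (hL : L.IsCycleOfLength n) (hx : x ∈ V(L)) :
    ∃ o : L.Walk x x, o.length = n := by
  obtain ⟨a, b, p, e, -, he, -, hV, -, rfl⟩ := hL
  rw [hV] at hx
  obtain ⟨p₁, p₂, rfl⟩ := p.exists_append_of_mem_support hx
  exact ⟨p₂.append (.cons e he p₁), by simp [Walk.length]; omega⟩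

lemma exists_inc (hL : L.IsCycleOfLength n) (hx : x ∈ V(L)) : ∃ f, L.Inc f x := by
  obtain ⟨o, ho⟩ := hL.exists_closed hx
  cases o with
  | nil => exact absurd ho.symm hL.ne_zero
  | cons f hf _ => exact ⟨f, hf.inc_left⟩

/-- A cycle stays connected when one of its edges is deleted. -/
lemma exists_walk_deleteEdges (hL : L.IsCycleOfLength n) (he : e ∈ E(L)) :
    ∃ a b, L.IsLink e a b ∧ (L.deleteEdges {e}).Reachable a b ∧ (n ≠ 1 → a ≠ b) := by
  obtain ⟨a, b, p, f, hp, hf, hfp, -, hE, rfl⟩ := hL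
  rw [hE] at he
  by_cases hef : e = f
  · subst hef
    refine ⟨a, b, hf.symm, ⟨p.toDeleteEdge e hfp⟩, fun hn hab ↦ ?_⟩
    subst hab
    exact hn (by rw [hp.length_eq_zero])
  · obtain ⟨c, d, p₁, p₂, hcd, hne⟩ := hp.exists_split (he.resolve_left hef)
    refine ⟨c, d, hcd, ⟨(p₂.append (.cons f ?_ p₁)).reverse⟩, fun _ ↦ hne⟩
    rw [deleteEdges_isLink]
    exact ⟨hf, Ne.symm hef⟩

/-- Even cycles violate rigidity. -/
lemma odd (hL : L.IsCycleOfLength n) (hH : H.IsRigid w) (hLH : L ≤ H) : Odd n := by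
  obtain ⟨a, b, p, e, hp, he, hep, -, -, rfl⟩ := hL
  have := hH.not_odd_of_isLink (he.mono hLH)
    ((p.mapLe hLH).toDeleteEdge e (by simpa using hep))
  simp only [Walk.length_toDeleteEdge, Walk.length_mapLe] at this
  grind

lemma eq_of_edgeSet_eq {m : ℕ} (h₁ : L₁.IsCycleOfLength n) (h₂ : L₂.IsCycleOfLength m)
    (hL₁ : L₁ ≤ H) (hL₂ : L₂ ≤ H) (hE : E(L₁) = E(L₂)) : L₁ = L₂ := by
  refine Compatible.ext (Set.Subset.antisymm (fun v hv ↦ ?_) fun v hv ↦ ?_) hE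
    (.of_le_le hL₁ hL₂)
  · obtain ⟨f, hf⟩ := h₁.exists_inc hv
    exact ((hL₂.inc_congr (hE ▸ hf.edge_mem)).2 (hf.mono hL₁)).vertex_mem
  · obtain ⟨f, hf⟩ := h₂.exists_inc hv
    exact ((hL₁.inc_congr (hE ▸ hf.edge_mem)).2 (hf.mono hL₂)).vertex_mem

end IsCycleOfLength

/-- A subgraph without the edge `e` is a subgraph of the graph with `e` deleted. -/
lemma le_deleteEdges_of_notMem (h : L ≤ H) (he : e ∉ E(L)) : L ≤ H.deleteEdges {e} :=
  ⟨by simpa using h.vertexSet_mono, fun f a b hf ↦ by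
    rw [deleteEdges_isLink]
    exact ⟨hf.mono h, fun hfe ↦ he (hfe ▸ hf.edge_mem)⟩⟩

/-- A cycle of a rigid graph that avoids `e` and is connected to `x` without `e` gives rise to an
odd closed walk at `x` that avoids `e`. -/
lemma IsRigid.exists_odd_closed (hH : H.IsRigid w) (hLH : L ≤ H) (hL : L.IsCycleOfLength n)
    (he : e ∉ E(L)) (hv : v ∈ V(L)) (q : (H.deleteEdges {e}).Walk x v) :
    ∃ o : (H.deleteEdges {e}).Walk x x, Odd o.length := by
  obtain ⟨o, ho⟩ := hL.exists_closed hv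
  refine ⟨q.append ((o.mapLe (le_deleteEdges_of_notMem hLH he)).append q.reverse), ?_⟩
  have := hL.odd hH hLH
  simp only [Walk.length_append, Walk.length_mapLe, Walk.length_reverse, ho]
  grind

/-- The edges of two cycles in one component of a rigid graph are the same: an edge on only one of
them would have its ends connected, and joined to the other cycle, without itself. -/
lemma IsRigid.edgeSet_subset_of_reachable {m : ℕ} (hH : H.IsRigid w) (hL₁ : L₁ ≤ H) (hL₂ : L₂ ≤ H)
    (h₁ : L₁.IsCycleOfLength n) (h₂ : L₂.IsCycleOfLength m) (hx : x ∈ V(L₁)) (hy : y ∈ V(L₂))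
    (hxy : H.Reachable x y) : E(L₁) ⊆ E(L₂) := by
  intro f hf
  by_contra hf₂
  obtain ⟨a, b, hab, ⟨q⟩, -⟩ := h₁.exists_walk_deleteEdges hf
  replace q := q.mapLe (deleteEdges_mono_left hL₁ {f})
  have hab' := hab.mono hL₁
  obtain ⟨r⟩ := h₁.reachable hab.left_mem hx
  obtain ⟨r'⟩ := hxy
  have key : Nonempty ((H.deleteEdges {f}).Walk a y) := by
    rcases ((r.mapLe hL₁).append r').exists_after_last hab' with h | ⟨h, -⟩ | ⟨h, -⟩
    · exact h
    · exact ⟨h⟩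
    · exact ⟨q.append h⟩
  obtain ⟨k⟩ := key
  obtain ⟨o, ho⟩ := hH.exists_odd_closed hL₂ h₂ hf₂ hy k
  exact hH.not_odd_of_reachable hab' q.reverse o ho

lemma IsRigid.cycle_eq_of_reachable {m : ℕ} (hH : H.IsRigid w) (hL₁ : L₁ ≤ H) (hL₂ : L₂ ≤ H)
    (h₁ : L₁.IsCycleOfLength n) (h₂ : L₂.IsCycleOfLength m) (hx : x ∈ V(L₁)) (hy : y ∈ V(L₂))
    (hxy : H.Reachable x y) : L₁ = L₂ :=
  h₁.eq_of_edgeSet_eq h₂ hL₁ hL₂ <|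
    (hH.edgeSet_subset_of_reachable hL₁ hL₂ h₁ h₂ hx hy hxy).antisymm
      (hH.edgeSet_subset_of_reachable hL₂ hL₁ h₂ h₁ hy hx (hxy.elim fun p ↦ ⟨p.reverse⟩))

/-- A path and an edge outside it that joins its ends form a cycle. -/
lemma Walk.IsPath.exists_cycle {p : H.Walk x y} (hp : p.IsPath) (he : H.IsLink e y x)
    (hep : e ∉ p.edges) : ∃ L ≤ H, L.IsCycleOfLength (p.length + 1) ∧ e ∈ E(L) ∧ x ∈ V(L) := by
  let F : Set β := insert e {f | f ∈ p.edges}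
  let L := (H.induce {v | v ∈ p.support}).restrict F
  have hlink {f : β} {a b : α} (hf : f ∈ F) (hab : H.IsLink f a b) : L.IsLink f a b := by
    have hmem {c : α} (hc : H.Inc f c) : c ∈ p.support := by
      rcases hf with rfl | hf
      · rcases hc.eq_or_eq_of_isLink he with rfl | rfl
        · exact p.end_mem_support
        · exact p.start_mem_support
      · exact p.mem_support_of_inc hf hc
    exact ⟨hf, hab, hmem hab.inc_left, hmem hab.inc_right⟩
  have hV : V(L) = {v | v ∈ p.support} := rfl
  have hE : E(L) = F := by
    refine Set.Subset.antisymm (fun f hf ↦ hf.2) fun f hf ↦ ?_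
    have hfH : f ∈ E(H) := by
      rcases hf with rfl | hf
      · exact he.edge_mem
      · exact p.mem_edgeSet hf
    obtain ⟨a, b, hab⟩ := exists_isLink_of_mem_edgeSet hfH
    exact (hlink hf hab).edge_mem
  obtain ⟨q, hqs, hqe⟩ : ∃ q : L.Walk x y, q.support = p.support ∧ q.edges = p.edges :=
    ⟨p.transfer L p.start_mem_support fun f hf a b ↦ hlink (.inr hf), support_transfer ..,
      edges_transfer ..⟩
  refine ⟨L, restrict_le.trans (induce_le fun v hv ↦ ?_), ⟨x, y, q, e, ?_, hlink (.inl rfl) he,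
    ?_, ?_, ?_, ?_⟩, ?_,
    p.start_mem_support⟩
  · obtain ⟨p₁, -, -⟩ := p.exists_append_of_mem_support hv
    exact p₁.right_mem
  · rwa [IsPath, hqs]
  · rwa [hqe]
  · rw [hV, hqs]
  · rw [hE, hqe]
  · rw [← length_edges, ← length_edges, hqe]
  · rw [hE]
    exact .inl rfl

/-- Unless a walk can be shortcut to a path whose length has the same parity, there is a cycle in
its component. -/
lemma Walk.exists_isPath_or_cycle {x y : α} (p : H.Walk x y) :
    (∃ q : H.Walk x y, q.IsPath ∧ (Even q.length ↔ Even p.length)) ∨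
      ∃ L ≤ H, (∃ n, L.IsCycleOfLength n) ∧ ∃ v ∈ V(L), H.Reachable x v := by
  induction p with
  | nil hx => exact .inl ⟨.nil hx, by simp [IsPath, support], Iff.rfl⟩
  | @cons x z y e he p ih =>
    rcases ih with ⟨q, hq, hpar⟩ | ⟨L, hLH, hL, v, hv, ⟨r⟩⟩
    · by_cases hx : x ∈ q.support
      · obtain ⟨q₁, q₂, rfl⟩ := q.exists_append_of_mem_support hx
        obtain ⟨hq₁, hq₂⟩ := hq.of_append
        by_cases heq : e ∈ q₁.edges
        · -- The path `q₁` from `z` to `x` consists of the edge `e` alone.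
          refine .inl ⟨q₂, hq₂, ?_⟩
          have h₁ : q₁.length = 1 := by
            cases q₁ with
            | nil => simp [edges] at heq
            | cons f hf r =>
              obtain ⟨hz, hr⟩ := isPath_cons.1 hq₁
              rcases List.mem_cons.1 heq with rfl | h
              · obtain rfl := he.symm.right_unique hf
                simp [length, hr.length_eq_zero]
              · exact absurd (r.mem_support_of_inc h he.inc_right) hz
          rw [length_append, h₁] at hpar
          simp only [length]
          grind
        · obtain ⟨L, hLH, hL, -, hz⟩ := hq₁.exists_cycle he heq
          exact .inr ⟨L, hLH, ⟨_, hL⟩, z, hz, ⟨.cons e he (.nil he.right_mem)⟩⟩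
      · refine .inl ⟨.cons e he q, isPath_cons.2 ⟨hx, hq⟩, ?_⟩
        simp only [length]
        grind
    · exact .inr ⟨L, hLH, hL, v, hv, ⟨.cons e he r⟩⟩

/-! ### The distinguished end of an edge -/

/-- If only one end of `e` is connected to `L` without `e`, then this end is closer to `L`. -/
lemma distTo_lt_of_reachable (he : H.IsLink e s t) (hv : v ∈ V(L))
    (hs : (H.deleteEdges {e}).Reachable s v)
    (ht : ∀ v ∈ V(L), ¬ (H.deleteEdges {e}).Reachable t v) : H.distTo s L < H.distTo t L := by
  have hne : {n | ∃ v ∈ V(L), ∃ p : H.Walk t v, p.IsPath ∧ p.length = n}.Nonempty := by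
    obtain ⟨q⟩ := hs
    obtain ⟨p, hp, -⟩ := (Walk.cons e he.symm (q.mapLe deleteEdges_le)).exists_isPath
    exact ⟨_, v, hv, p, hp, rfl⟩
  obtain ⟨v', hv', p, -, hlen⟩ := Nat.sInf_mem hne
  rcases p.exists_after_last he with h | ⟨q, hq⟩ | ⟨q, -⟩
  · exact absurd h (ht v' hv')
  · obtain ⟨r, hr, hrl⟩ := (q.mapLe (deleteEdges_le (G := H))).exists_isPath
    rw [Walk.length_mapLe] at hrl
    calc H.distTo s L ≤ r.length := Nat.sInf_le ⟨v', hv', r, hr, rfl⟩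
      _ < p.length := hrl.trans_lt hq
      _ = H.distTo t L := hlen
  · exact absurd ⟨q⟩ (ht v' hv')

lemma reachable_symm (h : H.Reachable x y) : H.Reachable y x := h.elim fun p ↦ ⟨p.reverse⟩

lemma reachable_trans (h : H.Reachable x y) (h' : H.Reachable y z) : H.Reachable x z :=
  h.elim fun p ↦ h'.elim fun q ↦ ⟨p.append q⟩

lemma Reachable.mono (h : K ≤ H) (hxy : K.Reachable x y) : H.Reachable x y :=
  hxy.elim fun p ↦ ⟨p.mapLe h⟩

lemma induce_reachable_le : H.induce {y | H.Reachable x y} ≤ H :=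
  induce_le fun _ h ↦ h.elim fun p ↦ p.right_mem

/-- An end of `e` at which no odd closed walk avoids `e` is an allowed choice. -/
lemma IsRigid.isEndpointChoice (hH : H.IsRigid w) (he : H.IsLink e s t)
    (ht : ∀ o : (H.deleteEdges {e}).Walk t t, ¬ Odd o.length) : H.IsEndpointChoice e t := by
  refine ⟨he.inc_right, ?_⟩
  rintro C L ⟨x, -, rfl⟩ heC ⟨⟨hLC, n, hL⟩, -⟩ heL s' hs' hne
  obtain rfl := (hs'.eq_or_eq_of_isLink he).resolve_right hne
  have hLH := hLC.trans induce_reachable_le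
  have hnot {v : α} (hv : v ∈ V(L)) : ¬ (H.deleteEdges {e}).Reachable t v := by
    rintro ⟨q⟩
    obtain ⟨o, ho⟩ := hH.exists_odd_closed hLH hL heL hv q
    exact ht o ho
  obtain ⟨v, hv⟩ := hL.exists_mem
  refine distTo_lt_of_reachable he hv ?_ fun v hv ↦ hnot hv
  obtain ⟨r⟩ : H.Reachable s' v := by
    have hs : H.Reachable x s' :=
      ((induce_reachable_le.inc_congr heC).2 he.inc_left).vertex_mem
    exact reachable_trans (reachable_symm hs) (hLC.vertexSet_mono hv)
  rcases r.exists_after_last he with h | ⟨h, -⟩ | ⟨h, -⟩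
  · exact h
  · exact ⟨h⟩
  · exact absurd ⟨h⟩ (hnot hv)

lemma IsRigid.exists_isEndpointChoice (hH : H.IsRigid w) (he : e ∈ E(H)) :
    ∃ t, H.IsEndpointChoice e t := by
  obtain ⟨a, b, hab⟩ := exists_isLink_of_mem_edgeSet he
  by_cases hb : ∃ o : (H.deleteEdges {e}).Walk b b, Odd o.length
  · obtain ⟨o, ho⟩ := hb
    exact ⟨a, hH.isEndpointChoice hab.symm fun o' ho' ↦ hH.not_odd_both hab o' o ho' ho⟩
  · exact ⟨b, hH.isEndpointChoice hab (not_exists.1 hb)⟩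

/-- An odd closed walk at `t` that avoids `e` would yield a cycle in the component of `t` without
`e`. This would be the only cycle in the component of `e`, and the other end of `e` would be
further from it than `t`. -/
lemma IsEndpointChoice.not_odd (ht : H.IsEndpointChoice e t) (hH : H.IsRigid w)
    (o : (H.deleteEdges {e}).Walk t t) : ¬ Odd o.length := by
  intro ho
  obtain ⟨⟨s, he⟩, hfar⟩ := ht
  have hst : ¬ (H.deleteEdges {e}).Reachable s t :=
    fun ⟨q⟩ ↦ hH.not_odd_of_reachable he q o ho
  have hne : s ≠ t := by
    rintro rfl
    exact hst ⟨o⟩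
  obtain ⟨q, hq, hpar⟩ | ⟨L, hLK, ⟨n, hL⟩, v, hv, htv⟩ := o.exists_isPath_or_cycle
  · rw [hq.length_eq_zero] at hpar
    exact Nat.not_even_iff_odd.2 ho (hpar.1 Even.zero)
  have hLH := hLK.trans deleteEdges_le
  have htL {z : α} (hz : z ∈ V(L)) : H.Reachable t z :=
    (reachable_trans htv ((hL.reachable hv hz).mono hLK)).mono deleteEdges_le
  have heL : e ∉ E(L) := fun h ↦ by simpa using hLK.edgeSet_mono h
  have hcomp : (H.induce {y | H.Reachable t y}).IsComponent H := ⟨t, he.left_mem, rfl⟩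
  have heC : e ∈ E(H.induce {y | H.Reachable t y}) :=
    ⟨t, s, he, ⟨.nil he.left_mem⟩, ⟨.cons e he (.nil he.right_mem)⟩⟩
  have honly : L.IsOnlyCycleIn (H.induce {y | H.Reachable t y}) := by
    refine ⟨⟨⟨fun z ↦ htL, fun f a b hab ↦ ⟨hab.mono hLH, htL hab.left_mem, htL hab.right_mem⟩⟩,
      n, hL⟩, ?_⟩
    rintro L' ⟨hL'C, m, hL'⟩
    obtain ⟨v', hv'⟩ := hL'.exists_mem
    exact hH.cycle_eq_of_reachable (hL'C.trans induce_reachable_le) hLH hL' hL hv' hv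
      (reachable_trans (reachable_symm (hL'C.vertexSet_mono hv')) (htL hv))
  have h₁ := hfar _ L hcomp heC honly heL s he.inc_right hne
  have h₂ := distTo_lt_of_reachable he hv htv fun z hz hsz ↦
    hst (reachable_trans hsz (reachable_trans ((hL.reachable hz hv).mono hLK)
      (reachable_symm htv)))
  exact h₁.asymm h₂

/-- Without odd closed walks at `t` that avoid `e`, two walks to `t` from the same vertex that avoid
`e` have lengths of the same parity. -/
lemma IsEndpointChoice.even_iff_even (ht : H.IsEndpointChoice e t) (hH : H.IsRigid w)
    (p q : (H.deleteEdges {e}).Walk v t) : Even p.length ↔ Even q.length := by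
  have := ht.not_odd hH (p.reverse.append q)
  simp only [Walk.length_append, Walk.length_reverse] at this
  grind

lemma IsEndpointChoice.existsUnique_isPath (ht : H.IsEndpointChoice e t) (hH : H.IsRigid w)
    (hv : (H.deleteEdges {e}).Reachable v t) :
    ∃! p : (H.deleteEdges {e}).Walk v t, p.IsPath := by
  obtain ⟨p⟩ := hv
  obtain ⟨p, hp, -⟩ := p.exists_isPath
  refine ⟨p, hp, fun q hq ↦ IsRigid.isPath_eq_of_alternation_eq hH.weight_pos hq hp ?_⟩
  simpa using hH.alternation_eq (q.mapLe deleteEdges_le) (p.mapLe deleteEdges_le)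
    (by simpa using ht.even_iff_even hH q p)

lemma IsEndpointChoice.neg_one_pow_pathDist (ht : H.IsEndpointChoice e t) (hH : H.IsRigid w)
    (p : (H.deleteEdges {e}).Walk v t) :
    (-1 : ℝ) ^ (H.deleteEdges {e}).pathDist v t = (-1) ^ p.length := by
  obtain ⟨p', hp', -⟩ := p.exists_isPath
  obtain ⟨q, -, hq⟩ := Nat.sInf_mem
    (⟨_, p', hp', rfl⟩ : {n | ∃ p : (H.deleteEdges {e}).Walk v t, p.IsPath ∧ p.length = n}.Nonempty)
  rw [pathDist, ← hq, neg_one_pow_congr (ht.even_iff_even hH q p)]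

lemma cycleCoeff_of_isLink_ne (he : H.IsLink e s t) (hst : s ≠ t)
    (h : (H.deleteEdges {e}).Reachable s t) : H.cycleCoeff e = 1 / 2 := by
  obtain ⟨p⟩ := h
  obtain ⟨p, hp, -⟩ := p.exists_isPath
  obtain ⟨L, hLH, hL, heL, -⟩ := ((Walk.isPath_mapLe deleteEdges_le).2 hp).exists_cycle he.symm
    (by simpa using p.notMem_edges_deleteEdges)
  refine if_pos ⟨L, hLH, ⟨_, fun h ↦ hst ?_, hL⟩, heL⟩
  cases p with
  | nil => rfl
  | cons => simp [Walk.length] at h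

lemma cycleCoeff_of_isLink_self (he : H.IsLink e t t) : H.cycleCoeff e = 1 := by
  refine if_neg ?_
  rintro ⟨L, hLH, ⟨n, hn, hL⟩, heL⟩
  obtain ⟨a, b, hab, -, hne⟩ := hL.exists_walk_deleteEdges heL
  rcases (hab.mono hLH).eq_and_eq_or_eq_and_eq he with ⟨rfl, rfl⟩ | ⟨rfl, rfl⟩ <;> exact hne hn rfl

lemma cycleCoeff_of_not_reachable (he : H.IsLink e s t)
    (h : ¬ (H.deleteEdges {e}).Reachable s t) : H.cycleCoeff e = 1 := by
  refine if_neg ?_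
  rintro ⟨L, hLH, ⟨n, -, hL⟩, heL⟩
  obtain ⟨a, b, hab, hr, -⟩ := hL.exists_walk_deleteEdges heL
  replace hr := hr.mono (deleteEdges_mono_left hLH {e})
  rcases (hab.mono hLH).eq_and_eq_or_eq_and_eq he with ⟨rfl, rfl⟩ | ⟨rfl, rfl⟩
  · exact h hr
  · exact h (reachable_symm hr)

end Graph

namespace Graph

variable {α β : Type*} {G H : Graph α β} {x y s t v : α} {e f : β}

/-! ### Extreme points and the incidence map -/

section Incidence

lemma mem_edgeSet_supportGraph {u : E(G) → ℝ} (e : E(G)) :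
    (e : β) ∈ E(G.supportGraph u) ↔ u e ≠ 0 := by
  simp [supportGraph]

open Classical in
lemma sum_inc_sub [Fintype E(G)] (x y : E(G) → ℝ) (v : α) :
    ∑ e : E(G), (if G.Inc e v then x e - y e else 0) =
      ∑ e : E(G), (if G.Inc e v then x e else 0) - ∑ e : E(G), (if G.Inc e v then y e else 0) := by
  rw [← Finset.sum_sub_distrib]
  refine Finset.sum_congr rfl fun e _ ↦ ?_
  split_ifs <;> simp

open Classical in
/-- The incidence map is injective on the vectors that vanish off the support of an extreme point
`u`: otherwise `u` could be moved a little in both directions of a vector in the kernel. -/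
lemma eq_zero_of_mem_extremePoints [Fintype E(G)] {b : V(G) → ℝ} {u : E(G) → ℝ}
    (hu : u ∈ (G.fracPerfectMatchingPolytope b).extremePoints ℝ) {y : E(G) → ℝ}
    (hy : ∀ e, u e = 0 → y e = 0)
    (hsum : ∀ v : V(G), ∑ e : E(G), (if G.Inc e v then y e else 0) = 0) : y = 0 := by
  obtain ⟨⟨hpos, hub⟩, hext⟩ := mem_extremePoints_iff_left.1 hu
  have key (z : E(G) → ℝ) (hz : ∀ e, u e = 0 → z e = 0) :
      ∀ᶠ ε : ℝ in nhdsWithin 0 (Set.Ioi 0), ∀ e, 0 ≤ u e + ε * z e := by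
    refine Filter.Eventually.filter_mono nhdsWithin_le_nhds (Filter.eventually_all.2 fun e ↦ ?_)
    rcases (hpos e).eq_or_lt with h | h
    · exact .of_forall fun ε ↦ by simp [← h, hz e h.symm]
    · have hc : ContinuousAt (fun ε : ℝ ↦ u e + ε * z e) 0 := by fun_prop
      exact (hc.eventually (lt_mem_nhds (by simpa using h))).mono fun ε ↦ le_of_lt
  obtain ⟨ε, ⟨h₁, h₂⟩, hε⟩ := (((key y hy).and (key (-y) (by simpa using hy))).and
    self_mem_nhdsWithin).exists
  have hmem (c : ℝ) (hc : ∀ e, 0 ≤ u e + c * y e) :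
      u + c • y ∈ G.fracPerfectMatchingPolytope b := by
    refine ⟨hc, fun v ↦ ?_⟩
    calc ∑ e : E(G), (if G.Inc e v then (u + c • y) e else 0)
        = ∑ e : E(G), (if G.Inc e v then u e else 0) +
          c * ∑ e : E(G), (if G.Inc e v then y e else 0) := by
          rw [Finset.mul_sum, ← Finset.sum_add_distrib]
          refine Finset.sum_congr rfl fun e _ ↦ ?_
          split_ifs <;> simp
      _ = b v := by rw [hub, hsum, mul_zero, add_zero]
  have h := hext _ (hmem ε h₁) _ (hmem (-ε) fun e ↦ by simpa using h₂ e)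
    ⟨1 / 2, 1 / 2, by norm_num, by norm_num, by norm_num, by ext e; simp; ring⟩
  have h' : ε • y = 0 := by simpa using h
  exact (smul_eq_zero.1 h').resolve_left (ne_of_gt hε)

lemma IsLink.inc_iff (he : G.IsLink e x y) : G.Inc e v ↔ v = x ∨ v = y :=
  ⟨fun h ↦ h.eq_or_eq_of_isLink he, by rintro (rfl | rfl); exacts [he.inc_left, he.inc_right]⟩

open Classical in
lemma sum_inc_of_isLink_ne [Fintype V(G)] (he : G.IsLink e x y) (hxy : x ≠ y) (g : α → ℝ) :
    ∑ v : V(G), (if G.Inc e v then g v else 0) = g x + g y := by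
  have h (v : V(G)) : (if G.Inc e v then g v else 0) =
      (if v = ⟨x, he.left_mem⟩ then g x else 0) + (if v = ⟨y, he.right_mem⟩ then g y else 0) := by
    obtain ⟨v, hv⟩ := v
    simp only [he.inc_iff, Subtype.mk.injEq]
    by_cases hvx : v = x
    · subst hvx
      simp [hxy]
    · by_cases hvy : v = y <;> simp [hvx, hvy, Ne.symm hxy]
  simp [h, Finset.sum_add_distrib]

open Classical in
lemma sum_inc_of_isLink_self [Fintype V(G)] (he : G.IsLink e x x) (g : α → ℝ) :
    ∑ v : V(G), (if G.Inc e v then g v else 0) = g x := by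
  have h (v : V(G)) : (if G.Inc e v then g v else 0) =
      (if v = ⟨x, he.left_mem⟩ then g x else 0) := by
    obtain ⟨v, hv⟩ := v
    simp only [he.inc_iff, Subtype.mk.injEq, or_self]
    by_cases hvx : v = x <;> simp [hvx]
  simp [h]

open Classical in
/-- The weights `2` for loops and `1` for the other edges. As a loop is counted once at its vertex,
every edge `e` with ends `x` and `y`, loop or not, satisfies that `incidenceWeight e` times the
incidence vector of `e` is `1_x + 1_y`. -/
noncomputable def incidenceWeight (G : Graph α β) (e : β) : ℝ :=
  if ∃ x, G.IsLoopAt e x then 2 else 1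

lemma incidenceWeight_pos (e : β) : 0 < G.incidenceWeight e := by
  rw [incidenceWeight]
  split_ifs <;> norm_num

open Classical in
lemma IsLink.ite_inc_incidenceWeight (he : G.IsLink e x y) (v : α) :
    (if G.Inc e v then G.incidenceWeight e else 0) =
      (if v = x then 1 else 0) + (if v = y then 1 else 0) := by
  by_cases hxy : x = y
  · subst hxy
    have hw : G.incidenceWeight e = 2 := if_pos ⟨x, he⟩
    by_cases hv : v = x <;> simp [he.inc_iff, hv, hw]
    norm_num
  · have hw : G.incidenceWeight e = 1 := by
      refine if_neg ?_
      rintro ⟨z, hz⟩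
      exact hxy ((hz.eq_of_inc he.inc_left).symm.trans (hz.eq_of_inc he.inc_right))
    rw [hw, he.inc_iff]
    by_cases hvx : v = x
    · subst hvx
      simp [hxy]
    · by_cases hvy : v = y <;> simp [hvx, hvy, Ne.symm hxy]

open Classical in
/-- The incidence map takes the alternating vector of a walk of length `n` from `x` to `y` to
`1_x - (-1) ^ n • 1_y`. -/
lemma Walk.sum_inc_alternation [Fintype E(G)] (v : α) : ∀ {x y : α} (p : G.Walk x y),
    ∑ f : E(G), (if G.Inc f v then alternation G.incidenceWeight p.edges f else 0) =
      (if v = x then 1 else 0) - (-1) ^ p.length * (if v = y then 1 else 0)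
  | _, _, nil _ => by simp [edges, alternation, length]
  | x, y, cons (y := z) e he p => by
    have ih := p.sum_inc_alternation v
    have h (f : E(G)) :
        (if G.Inc f v then alternation G.incidenceWeight (cons e he p).edges f else 0) =
          (if f = ⟨e, he.edge_mem⟩ then (if G.Inc e v then G.incidenceWeight e else 0) else 0) -
          (if G.Inc f v then alternation G.incidenceWeight p.edges f else 0) := by
      obtain ⟨f, hf⟩ := f
      by_cases hfe : f = e
      · subst hfe
        by_cases hv : G.Inc f v <;> simp [edges, alternation, hv]
      · by_cases hv : G.Inc f v <;> simp [edges, alternation, hv, hfe, Pi.single_eq_of_ne]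
    simp_rw [h]
    rw [Finset.sum_sub_distrib, ih, Finset.sum_ite_eq' Finset.univ, if_pos (Finset.mem_univ _),
      he.ite_inc_incidenceWeight, length, pow_succ]
    ring

/-- The graph of an extreme point is rigid. -/
lemma isRigid_supportGraph [Fintype E(G)] {b : V(G) → ℝ} {u : E(G) → ℝ}
    (hu : u ∈ (G.fracPerfectMatchingPolytope b).extremePoints ℝ) :
    (G.supportGraph u).IsRigid G.incidenceWeight := by
  classical
  refine ⟨incidenceWeight_pos, fun {x y} p q hpq ↦ ?_⟩
  have hle : G.supportGraph u ≤ G := restrict_le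
  have hzero (p : (G.supportGraph u).Walk x y) {f : β} (hf : f ∉ E(G.supportGraph u)) :
      alternation G.incidenceWeight p.edges f = 0 :=
    alternation_of_notMem fun h ↦ hf (p.mem_edgeSet h)
  have h := eq_zero_of_mem_extremePoints hu (y := fun f ↦
    alternation G.incidenceWeight p.edges f - alternation G.incidenceWeight q.edges f)
    (fun f hf ↦ by
      have hf' : (f : β) ∉ E(G.supportGraph u) := fun h ↦ (mem_edgeSet_supportGraph f).1 h hf
      simp [hzero p hf', hzero q hf'])
    (fun v ↦ by
      have hp := (p.mapLe hle).sum_inc_alternation (v : α)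
      have hq := (q.mapLe hle).sum_inc_alternation (v : α)
      rw [Walk.edges_mapLe, Walk.length_mapLe] at hp hq
      rw [sum_inc_sub (fun f : E(G) ↦ alternation G.incidenceWeight p.edges f)
        (fun f : E(G) ↦ alternation G.incidenceWeight q.edges f), hp, hq, neg_one_pow_congr hpq,
        sub_self])
  ext f
  by_cases hf : f ∈ E(G.supportGraph u)
  · exact sub_eq_zero.1 (congrFun h ⟨f, hle.edgeSet_mono hf⟩)
  · rw [hzero p hf, hzero q hf]

end Incidence

/-! ### The formula for the entries of an extreme point -/

open Classical in
/-- The sign `(-1) ^ d(v, t)` of a vertex `v` in the component of `t` without the edge `e`, and `0`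
for the other vertices. -/
noncomputable def componentSign (H : Graph α β) (e : β) (t v : α) : ℝ :=
  if (H.deleteEdges {e}).Reachable v t then (-1) ^ (H.deleteEdges {e}).pathDist v t else 0

lemma IsEndpointChoice.componentSign_eq {w : β → ℝ} (ht : H.IsEndpointChoice e t)
    (hH : H.IsRigid w) (p : (H.deleteEdges {e}).Walk v t) :
    H.componentSign e t v = (-1) ^ p.length := by
  rw [componentSign, if_pos ⟨p⟩, ht.neg_one_pow_pathDist hH p]

lemma componentSign_of_not_reachable (h : ¬ (H.deleteEdges {e}).Reachable v t) :
    H.componentSign e t v = 0 := if_neg h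

/-- The ends of an edge other than `e` have opposite signs. For a loop, this says that the sign of
its vertex is `0`. -/
lemma IsEndpointChoice.componentSign_add_eq_zero {w : β → ℝ} (ht : H.IsEndpointChoice e t)
    (hH : H.IsRigid w) (hf : H.IsLink f x y) (hfe : f ≠ e) :
    H.componentSign e t x + H.componentSign e t y = 0 := by
  have hf' : (H.deleteEdges {e}).IsLink f x y := by
    rw [deleteEdges_isLink]
    exact ⟨hf, hfe⟩
  by_cases h : (H.deleteEdges {e}).Reachable y t
  · obtain ⟨q⟩ := h
    rw [ht.componentSign_eq hH q, ht.componentSign_eq hH (.cons f hf' q), Walk.length, pow_succ]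
    ring
  · rw [componentSign_of_not_reachable h, componentSign_of_not_reachable, add_zero]
    exact fun ⟨p⟩ ↦ h ⟨.cons f hf'.symm p⟩

open Classical in
/-- Summing the signs over the ends of `e` gives `2` if `e` lies on a nonloop cycle, which is odd,
and `1` otherwise. -/
lemma IsEndpointChoice.cycleCoeff_mul_sum [Fintype V(G)] {w : β → ℝ} (ht : H.IsEndpointChoice e t)
    (hH : H.IsRigid w) (hHG : H ≤ G) :
    H.cycleCoeff e * ∑ v : V(G), (if G.Inc e v then H.componentSign e t v else 0) = 1 := by
  obtain ⟨s, he⟩ := ht.1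
  have hone : H.componentSign e t t = 1 := by
    exact (ht.componentSign_eq hH (.nil he.left_mem)).trans (pow_zero _)
  by_cases hst : t = s
  · subst hst
    rw [sum_inc_of_isLink_self (he.mono hHG), cycleCoeff_of_isLink_self he, hone, one_mul]
  rw [sum_inc_of_isLink_ne (he.mono hHG) hst, hone]
  by_cases h : (H.deleteEdges {e}).Reachable s t
  · obtain ⟨q⟩ := h
    have hq := Nat.not_odd_iff_even.1 (hH.not_odd_of_isLink he q)
    rw [cycleCoeff_of_isLink_ne he.symm (Ne.symm hst) ⟨q⟩, ht.componentSign_eq hH q,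
      hq.neg_one_pow]
    norm_num
  · rw [cycleCoeff_of_not_reachable he.symm h, componentSign_of_not_reachable h]
    norm_num

open Classical in
/-- The alternating sum of the vertex equations over the component of `t` without `e` determines
the value at `e`: the contributions of all other edges cancel. -/
lemma IsEndpointChoice.eq_cycleCoeff_mul [Fintype V(G)] [Fintype E(G)] {w : β → ℝ}
    {b : V(G) → ℝ} {u : E(G) → ℝ} (hu : u ∈ G.fracPerfectMatchingPolytope b) (e : E(G))
    (ht : (G.supportGraph u).IsEndpointChoice e t) (hH : (G.supportGraph u).IsRigid w) :
    u e = (G.supportGraph u).cycleCoeff e *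
      ∑ v : V(G), (G.supportGraph u).componentSign e t v * b v := by
  set H := G.supportGraph u
  have hHG : H ≤ G := restrict_le
  have hswap : ∑ v : V(G), H.componentSign e t v * b v =
      ∑ f : E(G), u f * ∑ v : V(G), (if G.Inc f v then H.componentSign e t v else 0) := by
    simp_rw [← hu.2, Finset.mul_sum]
    rw [Finset.sum_comm]
    refine Finset.sum_congr rfl fun f _ ↦ Finset.sum_congr rfl fun v _ ↦ ?_
    split_ifs <;> ring
  rw [hswap, Finset.sum_eq_single e, mul_left_comm, ht.cycleCoeff_mul_sum hH hHG, mul_one]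
  · intro f _ hfe
    by_cases huf : u f = 0
    · rw [huf, zero_mul]
    obtain ⟨x, y, hxy⟩ := exists_isLink_of_mem_edgeSet ((mem_edgeSet_supportGraph f).2 huf)
    have h0 := ht.componentSign_add_eq_zero hH hxy fun h ↦ hfe (Subtype.ext h)
    by_cases hne : x = y
    · subst hne
      rw [sum_inc_of_isLink_self (hxy.mono hHG), add_self_eq_zero.1 h0, mul_zero]
    · rw [sum_inc_of_isLink_ne (hxy.mono hHG) hne, h0, mul_zero]
  · exact fun h ↦ absurd (Finset.mem_univ e) h

end Graph

open Classical in
theorem theorem7p8 {α β : Type*} (G : Graph α β) [Fintype V(G)] [Fintype E(G)]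
    (b : V(G) → ℝ) (hb : ∀ v, 0 ≤ b v) (u : E(G) → ℝ)
    (hu : u ∈ (G.fracPerfectMatchingPolytope b).extremePoints ℝ)
    (H : Graph α β) (hH : H = G.supportGraph u) :
    (∀ x ∈ G.fracPerfectMatchingPolytope b, G.supportGraph x = H ↔ x = u) ∧
    (∀ e : E(G), (e : β) ∉ E(H) → u e = 0) ∧
    ∀ e : E(G), (e : β) ∈ E(H) →
      (∃ t, H.IsEndpointChoice e t) ∧
      ∀ t, H.IsEndpointChoice e t →
        (∀ v, (H.deleteEdges {(e : β)}).Reachable v t →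
          ∃! p : (H.deleteEdges {(e : β)}).Walk v t, p.IsPath) ∧
        u e = H.cycleCoeff e *
          ∑ v : V(G), (if (H.deleteEdges {(e : β)}).Reachable v t then
            (-1) ^ (H.deleteEdges {(e : β)}).pathDist v t * b v else 0) := by
  subst hH
  have hR := Graph.isRigid_supportGraph hu
  refine ⟨fun x hx ↦ ⟨fun h ↦ ?_, fun h ↦ by rw [h]⟩,
    fun e he ↦ not_not.1 fun h ↦ he ((Graph.mem_edgeSet_supportGraph e).2 h),
    fun e he ↦ ⟨hR.exists_isEndpointChoice he, fun t ht ↦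
      ⟨fun v hv ↦ ht.existsUnique_isPath hR hv, ?_⟩⟩⟩
  · -- Two points with the same graph differ by a vector in the kernel of the incidence map.
    refine sub_eq_zero.1 (Graph.eq_zero_of_mem_extremePoints hu (fun e he ↦ ?_) fun v ↦ ?_)
    · have hxe : x e = 0 := by
        by_contra hxe
        have := (Graph.mem_edgeSet_supportGraph e).2 hxe
        rw [h] at this
        exact (Graph.mem_edgeSet_supportGraph e).1 this he
      simp [hxe, he]
    · exact (Graph.sum_inc_sub x u v).trans (by rw [hx.2, hu.1.2, sub_self])
  · rw [ht.eq_cycleCoeff_mul hu.1 e hR]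
    congr 1
    refine Finset.sum_congr rfl fun v _ ↦ ?_
    rw [Graph.componentSign, ite_mul, zero_mul]
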